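/- Let $d\ge 1$ be an integer, $\omega=e^{2\pi i/(2d-1)}$, $\nu=e^{2\pi i/3}$, let $\mathbb S$ be the unit circle in $\mathbb C$, and write $\|h\|_\infty=\max_{z\in\mathbb S}|h(z)|$ and $\|p\|_2=\bigl(\int_0^{2\pi}|p(e^{it})|^2\,dt\bigr)^{1/2}$. There is a map $R$, depending only on $d$, from real data $y=(y_{l,j})_{0\le l\le 2d-2,\;0\le j\le 3}$ to complex polynomials of degree at most $d-1$, with the following property. For all constants $m,M,M'>0$ there is a constant $C>0$, depending only on $d,m,M,M'$, such that the following holds. Put $$\beta=\frac{1}{1+2\left(1+\frac{(d-1)M+M'}{m}\right)} .$$ Let $f$ be a complex polynomial of degree at most $d-1$ with $m\le|f(z)|\le M$ and $|f'(z)|\le M'$ for all $z\in\mathbb S$, let $0<\epsilon<\frac{\beta m^2}{(2d-1)d}$, and let $$y_{l,0}=|f(\omega^l)|^2+\epsilon_{l,0},\qquad y_{l,j}=|f(\omega^l)+\nu^jf'(\omega^l)|^2+\epsilon_{l,j}\qquad(0\le l\le 2d-2,\ j=1,2,3)$$ be the $8d-4$ perturbed measurements, with real errors satisfying $|\epsilon_{l,j}|\le\epsilon$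 for all $l,j$. Then the quantity $\rho(y)=\bigl(\frac{2\pi}{2d-1}\sum_{l=0}^{2d-2}y_{l,0}\bigr)^{1/2}$ satisfies $\bigl|\rho(y)-\|f\|_2\bigr|\le C\epsilon$, and the polynomial $g=R(y)$ has norm $\|g\|_2=\rho(y)$, has no zero on $\mathbb S$, and satisfies $$\left\|\frac fg-c\right\|_\infty\le C\,\epsilon\qquad\text{for some } c\in\mathbb C \text{ with } |c|=1 .$$ -/

import Mathlib

/-- The maximum norm on the unit circle, `max_{|z| = 1} |h z|`. -/
noncomputable def circleSupNorm (h : ℂ → ℂ) : ℝ :=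
  ⨆ z : Circle, ‖h z‖

/-- The norm of a polynomial in `L²` of the unit circle, with respect to the (unnormalized)
Lebesgue measure `dt` on `[0, 2π]`. -/
noncomputable def circleL2Norm (p : Polynomial ℂ) : ℝ :=
  Real.sqrt (∫ t in (0 : ℝ)..(2 * Real.pi), ‖p.eval (Complex.exp (t * Complex.I))‖ ^ 2)

/-- The primitive root of unity `e^{2πi/n}`. -/
noncomputable def unityRoot (n : ℕ) : ℂ :=
  Complex.exp (2 * Real.pi * Complex.I / n)

/-- The `8d - 4 = 4 (2d - 1)` noiseless magnitude measurements of `f`. With `ω = e^{2πi/(2d-1)}`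
and `ν = e^{2πi/3}`, the entry `(l, 0)` is `|f(ω^l)|²` and, for `j = 1, 2, 3`, the entry `(l, j)`
is `|f(ω^l) + ν^j f'(ω^l)|²`. -/
noncomputable def measurement (d : ℕ) (f : Polynomial ℂ) (l : Fin (2 * d - 1)) (j : Fin 4) : ℝ :=
  if j = 0 then
    ‖f.eval (unityRoot (2 * d - 1) ^ (l : ℕ))‖ ^ 2
  else
    ‖f.eval (unityRoot (2 * d - 1) ^ (l : ℕ)) +
      unityRoot 3 ^ (j : ℕ) * f.derivative.eval (unityRoot (2 * d - 1) ^ (l : ℕ))‖ ^ 2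

/-- The constant `β = 1 / (1 + 2 (1 + ((d - 1) M + M') / m))`. -/
noncomputable def noiseBeta (d : ℕ) (m M M' : ℝ) : ℝ :=
  1 / (1 + 2 * (1 + (((d : ℝ) - 1) * M + M') / m))

/-- The estimate of the `L²` norm by Parseval's identity from the (perturbed) values of `|f|²` at
the `2d - 1` equidistant points. -/
noncomputable def normEstimate (d : ℕ) (y : Fin (2 * d - 1) → Fin 4 → ℝ) : ℝ :=
  Real.sqrt (2 * Real.pi / (2 * (d : ℝ) - 1) * ∑ l, y l 0)

/-!
The reconstruction `R y` is a best fit: among the polynomials `g` of degree less than `d` whose `L²`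
norm is the one prescribed by the data, it minimizes the least `t` such that every measurement of
`g` deviates from the data by at most `t` and by at most `t * min |g|` (`FitsData`,
`exists_best_fit`). The minimum exists by compactness and involves none of the constants
`m`, `M`, `M'`, `ε`.

*The residual is `O(ε)`.* On the unit circle `|f|²` and `|f + ν^j f'|²` are trigonometric
polynomials of degree at most `d - 1`. The quadrature rule with `2d - 1` equidistant nodes
integrates them exactly (`integral_normSq_eval`), so the norm prescribed by the data is within
`O(ε)` of `‖f‖₂`. Hence the multiple of `f` that has the prescribed norm fits the data up to a
residual `K ε` (`exists_fitsData`), and so does `g = R y`.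

*Lower bound for `g`.* A trigonometric polynomial of degree at most `d - 1` is bounded on the circle
by `2d - 1` times its maximum at the nodes (`abs_normSq_sub_le`). Therefore
`|f z|² - |g z|² ≤ (2d - 1) (K ε |g z| + ε)`, and the bound `(2d - 1) ε ≤ m² / 3` keeps `|g|` above
a constant `μ` that depends only on `m`, `M`, `M'` (`FitsData.le_norm_eval`). It is for this step
that the residual is compared with `t * min |g|`: the noise level is not assumed to be smaller
than some inexplicit constant.

*Stability.* Polarization with the cube roots of unity recovers `conj f * f'` from the numbers
`|f + ν^j f'|²` (`polarization_unityRoot_three`). So `|f|²` and `conj f * f'` are within `O(ε)` of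
`|g|²` and `conj g * g'`, and then so are the logarithmic derivatives
`f' / f = (conj f * f') / |f|²` and `g' / g`. Thus `f / g` has derivative `O(ε)` along the circle,
while its modulus is `1 + O(ε)`; it is within `O(ε)` of a unimodular constant
(`exists_norm_div_sub_le`).
-/

open Polynomial Finset
open scoped ComplexConjugate

/-! ### Values at the roots of unity -/

theorem isPrimitiveRoot_unityRoot {n : ℕ} (hn : n ≠ 0) : IsPrimitiveRoot (unityRoot n) n :=
  Complex.isPrimitiveRoot_exp n hn

theorem norm_unityRoot_pow {n : ℕ} (hn : n ≠ 0) (l : ℕ) : ‖unityRoot n ^ l‖ = 1 := by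
  rw [norm_pow, (isPrimitiveRoot_unityRoot hn).norm'_eq_one hn, one_pow]

theorem sum_pow_mul_inv_pow_unityRoot {n i k : ℕ} (hi : i < n) (hk : k < n) :
    ∑ l : Fin n, (unityRoot n ^ (l : ℕ)) ^ i * ((unityRoot n ^ (l : ℕ)) ^ k)⁻¹ =
      if i = k then (n : ℂ) else 0 := by
  have hn : n ≠ 0 := by omega
  have hζ := isPrimitiveRoot_unityRoot hn
  have h0 : unityRoot n ≠ 0 := hζ.ne_zero hn
  have key : ∀ l : ℕ, (unityRoot n ^ l) ^ i * ((unityRoot n ^ l) ^ k)⁻¹ =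
      (unityRoot n ^ i * (unityRoot n ^ k)⁻¹) ^ l := by
    intro l
    rw [mul_pow, inv_pow, ← pow_mul, ← pow_mul, ← pow_mul, ← pow_mul, mul_comm l i, mul_comm l k]
  simp_rw [key]
  rw [Fin.sum_univ_eq_sum_range (fun l => (unityRoot n ^ i * (unityRoot n ^ k)⁻¹) ^ l) n]
  split_ifs with h
  · subst h
    simp [mul_inv_cancel₀ (pow_ne_zero i h0)]
  · have hne : unityRoot n ^ i * (unityRoot n ^ k)⁻¹ ≠ 1 := by
      intro h1
      rw [mul_inv_eq_one₀ (pow_ne_zero k h0)] at h1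
      exact h (hζ.pow_inj hi hk h1)
    rw [geom_sum_eq hne, mul_pow, inv_pow, ← pow_mul, ← pow_mul, mul_comm i, mul_comm k, pow_mul,
      pow_mul, hζ.pow_eq_one]
    simp

/-- The inverse discrete Fourier transform: the values at the `n`-th roots of unity determine the
coefficients of a polynomial of degree less than `n`. -/
theorem natCast_mul_coeff_eq_sum_eval_unityRoot {n : ℕ} {P : ℂ[X]} (hP : P.natDegree < n) {k : ℕ}
    (hk : k < n) :
    (n : ℂ) * P.coeff k =
      ∑ l : Fin n, P.eval (unityRoot n ^ (l : ℕ)) * ((unityRoot n ^ (l : ℕ)) ^ k)⁻¹ := by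
  simp_rw [eval_eq_sum_range' hP, Finset.sum_mul]
  rw [Finset.sum_comm]
  simp_rw [mul_assoc, ← Finset.mul_sum]
  rw [Finset.sum_congr rfl fun i hi => by
    rw [sum_pow_mul_inv_pow_unityRoot (Finset.mem_range.1 hi) hk]]
  simp [hk, mul_comm]

theorem norm_coeff_le_of_norm_eval_unityRoot_le {n : ℕ} {P : ℂ[X]} (hP : P.natDegree < n) {δ : ℝ}
    (h : ∀ l : Fin n, ‖P.eval (unityRoot n ^ (l : ℕ))‖ ≤ δ) {k : ℕ} (hk : k < n) :
    ‖P.coeff k‖ ≤ δ := by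
  have hn : n ≠ 0 := by omega
  have hn' : (0 : ℝ) < n := by positivity
  have h1 : (n : ℝ) * ‖P.coeff k‖ ≤ n * δ := by
    calc (n : ℝ) * ‖P.coeff k‖ = ‖(n : ℂ) * P.coeff k‖ := by simp
      _ ≤ ∑ l : Fin n, ‖P.eval (unityRoot n ^ (l : ℕ)) * ((unityRoot n ^ (l : ℕ)) ^ k)⁻¹‖ := by
          rw [natCast_mul_coeff_eq_sum_eval_unityRoot hP hk]
          exact norm_sum_le _ _
      _ ≤ ∑ _l : Fin n, δ := by
          refine Finset.sum_le_sum fun l _ => ?_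
          rw [norm_mul, norm_inv, norm_pow, norm_unityRoot_pow hn]
          simpa using h l
      _ = n * δ := by simp
  exact le_of_mul_le_mul_left h1 hn'

theorem norm_eval_le_of_norm_eval_unityRoot_le {n : ℕ} {P : ℂ[X]} (hP : P.natDegree < n) {δ : ℝ}
    (h : ∀ l : Fin n, ‖P.eval (unityRoot n ^ (l : ℕ))‖ ≤ δ) {z : ℂ} (hz : ‖z‖ = 1) :
    ‖P.eval z‖ ≤ n * δ := by
  rw [eval_eq_sum_range' hP]
  calc ‖∑ i ∈ range n, P.coeff i * z ^ i‖ ≤ ∑ i ∈ range n, ‖P.coeff i * z ^ i‖ := norm_sum_le _ _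
    _ ≤ ∑ _i ∈ range n, δ := by
        refine Finset.sum_le_sum fun i hi => ?_
        rw [norm_mul, norm_pow, hz, one_pow, mul_one]
        exact norm_coeff_le_of_norm_eval_unityRoot_le hP h (mem_range.1 hi)
    _ = n * δ := by simp

/-! ### Squared moduli as trigonometric polynomials -/

/-- For `p` of degree less than `d`, the polynomial that agrees with `z ^ (d - 1) * |p z|²` on the
unit circle. The factor `z ^ (d - 1)` turns the trigonometric polynomial `|p|²` into a polynomial of
degree at most `2d - 2`. -/
noncomputable def normSqPoly (d : ℕ) (p : ℂ[X]) : ℂ[X] :=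
  p * (p.map (starRingEnd ℂ)).reflect (d - 1)

theorem natDegree_lt_of_mem_degreeLT {d : ℕ} (hd : 0 < d) {p : ℂ[X]} (hp : p ∈ degreeLT ℂ d) :
    p.natDegree < d := by
  by_cases h : p = 0
  · simpa [h] using hd
  · exact (natDegree_lt_iff_degree_lt h).2 (mem_degreeLT.1 hp)

theorem natDegree_normSqPoly_lt {d : ℕ} (hd : 0 < d) {p : ℂ[X]} (hp : p ∈ degreeLT ℂ d) :
    (normSqPoly d p).natDegree < 2 * d - 1 := by
  have h := natDegree_lt_of_mem_degreeLT hd hp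
  have h1 : ((p.map (starRingEnd ℂ)).reflect (d - 1)).natDegree ≤ d - 1 := by
    refine (natDegree_reflect_le).trans ?_
    have := natDegree_map_le (p := p) (f := starRingEnd ℂ)
    omega
  have := natDegree_mul_le (p := p) (q := (p.map (starRingEnd ℂ)).reflect (d - 1))
  unfold normSqPoly
  omega

theorem eval_normSqPoly {d : ℕ} (hd : 0 < d) {p : ℂ[X]} (hp : p ∈ degreeLT ℂ d) {z : ℂ}
    (hz : ‖z‖ = 1) : (normSqPoly d p).eval z = z ^ (d - 1) * ((‖p.eval z‖ ^ 2 : ℝ) : ℂ) := by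
  have h := natDegree_lt_of_mem_degreeLT hd hp
  have hc : conj z * z = 1 := by rw [Complex.conj_mul', hz]; simp
  have hdeg : (p.map (starRingEnd ℂ)).natDegree ≤ d - 1 :=
    (natDegree_map_le).trans (by omega)
  let _ : Invertible (conj z) := ⟨z, by rw [mul_comm, hc], hc⟩
  have key := eval₂_reflect_mul_pow (RingHom.id ℂ) (conj z) (d - 1) (p.map (starRingEnd ℂ)) hdeg
  have hinv : ⅟(conj z) = z := invOf_eq_right_inv hc
  rw [hinv] at key
  have h2 : eval₂ (RingHom.id ℂ) (conj z) (p.map (starRingEnd ℂ)) = conj (p.eval z) := by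
    rw [eval₂_map, RingHom.id_comp, eval₂_at_apply]
  rw [h2] at key
  have h3 : ((p.map (starRingEnd ℂ)).reflect (d - 1)).eval z = z ^ (d - 1) * conj (p.eval z) := by
    rw [← key, mul_left_comm, ← mul_pow, mul_comm z, hc, one_pow, mul_one]
    rfl
  rw [normSqPoly, eval_mul, h3]
  push_cast
  rw [← Complex.conj_mul']
  ring

/-- Values of a trigonometric polynomial of degree at most `d - 1` at `2d - 1` equidistant points
control its values on the whole unit circle. -/
theorem abs_normSq_sub_le {d : ℕ} (hd : 0 < d) {p q : ℂ[X]} (hp : p ∈ degreeLT ℂ d)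
    (hq : q ∈ degreeLT ℂ d) {δ : ℝ}
    (h : ∀ l : Fin (2 * d - 1), |‖p.eval (unityRoot (2 * d - 1) ^ (l : ℕ))‖ ^ 2 -
      ‖q.eval (unityRoot (2 * d - 1) ^ (l : ℕ))‖ ^ 2| ≤ δ) {z : ℂ} (hz : ‖z‖ = 1) :
    |‖p.eval z‖ ^ 2 - ‖q.eval z‖ ^ 2| ≤ ((2 * d - 1 : ℕ) : ℝ) * δ := by
  have hn : 2 * d - 1 ≠ 0 := by omega
  have key : ∀ {w : ℂ}, ‖w‖ = 1 → ‖(normSqPoly d p - normSqPoly d q).eval w‖ =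
      |‖p.eval w‖ ^ 2 - ‖q.eval w‖ ^ 2| := by
    intro w hw
    rw [eval_sub, eval_normSqPoly hd hp hw, eval_normSqPoly hd hq hw, ← mul_sub, norm_mul,
      norm_pow, hw, one_pow, one_mul, ← Complex.ofReal_sub, Complex.norm_real, Real.norm_eq_abs]
  rw [← key hz]
  refine norm_eval_le_of_norm_eval_unityRoot_le ?_ (fun l => ?_) hz
  · refine (natDegree_sub_le _ _).trans_lt ?_
    exact max_lt (natDegree_normSqPoly_lt hd hp) (natDegree_normSqPoly_lt hd hq)
  · rw [key (norm_unityRoot_pow hn _)]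
    exact h l

theorem integral_exp_intCast_mul (k : ℤ) (hk : k ≠ 0) :
    ∫ t in (0 : ℝ)..(2 * Real.pi), Complex.exp (k * Complex.I * t) = 0 := by
  have hc : (k : ℂ) * Complex.I ≠ 0 := mul_ne_zero (by exact_mod_cast hk) Complex.I_ne_zero
  rw [integral_exp_mul_complex hc]
  have : (k : ℂ) * Complex.I * ((2 * Real.pi : ℝ) : ℂ) = k * (2 * Real.pi * Complex.I) := by
    push_cast; ring
  rw [this, Complex.exp_int_mul_two_pi_mul_I]
  simp

/-- Parseval's identity in sampled form: the trigonometric polynomial `|p|²` is integrated exactly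
by the quadrature rule with `2d - 1` equidistant nodes. -/
theorem integral_normSq_eval {d : ℕ} (hd : 0 < d) {p : ℂ[X]} (hp : p ∈ degreeLT ℂ d) :
    ∫ t in (0 : ℝ)..(2 * Real.pi), ‖p.eval (Complex.exp (t * Complex.I))‖ ^ 2 =
      2 * Real.pi / (2 * (d : ℝ) - 1) *
        ∑ l : Fin (2 * d - 1), ‖p.eval (unityRoot (2 * d - 1) ^ (l : ℕ))‖ ^ 2 := by
  have hn : 2 * d - 1 ≠ 0 := by omega
  have hcast : ((2 * d - 1 : ℕ) : ℂ) = 2 * (d : ℂ) - 1 := by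
    rw [Nat.cast_sub (by omega)]; push_cast; ring
  have hlt : d - 1 < 2 * d - 1 := by omega
  have hdeg := natDegree_normSqPoly_lt hd hp
  have hnorm : ∀ t : ℝ, ((‖p.eval (Complex.exp (t * Complex.I))‖ ^ 2 : ℝ) : ℂ) =
      ∑ i ∈ range (2 * d - 1), (normSqPoly d p).coeff i *
        Complex.exp (((i - (d - 1 : ℕ) : ℤ) : ℂ) * Complex.I * t) := by
    intro t
    have h := eval_normSqPoly hd hp (Complex.norm_exp_ofReal_mul_I t)
    have h0 : Complex.exp (t * Complex.I) ^ (d - 1) ≠ 0 := pow_ne_zero _ (Complex.exp_ne_zero _)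
    rw [eq_comm, ← mul_right_inj' h0, ← h, eval_eq_sum_range' hdeg, Finset.mul_sum]
    refine Finset.sum_congr rfl fun i _ => ?_
    rw [mul_left_comm, ← Complex.exp_nat_mul, ← Complex.exp_nat_mul, ← Complex.exp_add]
    congr 2
    push_cast
    ring
  have hint : ((∫ t in (0 : ℝ)..(2 * Real.pi), ‖p.eval (Complex.exp (t * Complex.I))‖ ^ 2 : ℝ) : ℂ)
      = 2 * Real.pi * (normSqPoly d p).coeff (d - 1) := by
    rw [← intervalIntegral.integral_ofReal]
    simp_rw [hnorm]
    rw [intervalIntegral.integral_finsetSum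
      (fun i _ => (Continuous.intervalIntegrable (by fun_prop) _ _))]
    -- Only the frequency `0`, which is the coefficient of index `d - 1`, has a nonzero integral.
    rw [Finset.sum_eq_single (d - 1)]
    · simp [mul_comm]
    · intro i _ hi
      rw [intervalIntegral.integral_const_mul, integral_exp_intCast_mul _ (by omega), mul_zero]
    · intro h; exact absurd (mem_range.2 hlt) h
  have hcoef := natCast_mul_coeff_eq_sum_eval_unityRoot hdeg hlt
  have hsum : ∑ l : Fin (2 * d - 1), (normSqPoly d p).eval (unityRoot (2 * d - 1) ^ (l : ℕ)) *
      ((unityRoot (2 * d - 1) ^ (l : ℕ)) ^ (d - 1))⁻¹ =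
      ((∑ l : Fin (2 * d - 1), ‖p.eval (unityRoot (2 * d - 1) ^ (l : ℕ))‖ ^ 2 : ℝ) : ℂ) := by
    rw [Complex.ofReal_sum]
    refine Finset.sum_congr rfl fun l _ => ?_
    have h1 := norm_unityRoot_pow hn (l : ℕ)
    rw [eval_normSqPoly hd hp h1, mul_right_comm, mul_inv_cancel₀, one_mul]
    exact pow_ne_zero _ (norm_ne_zero_iff.1 (by rw [h1]; exact one_ne_zero))
  rw [hsum] at hcoef
  have hne : (2 * (d : ℂ) - 1) ≠ 0 := by rw [← hcast]; exact_mod_cast hn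
  apply Complex.ofReal_injective
  rw [hint, Complex.ofReal_mul, ← hcoef, hcast]
  push_cast
  field_simp

/-! ### Polarization -/

theorem one_add_unityRoot_three : 1 + unityRoot 3 + unityRoot 3 ^ 2 = 0 := by
  have h := (isPrimitiveRoot_unityRoot (n := 3) (by norm_num)).geom_sum_eq_zero (by norm_num)
  simpa [Finset.sum_range_succ] using h

theorem conj_unityRoot_three : conj (unityRoot 3) = -1 - unityRoot 3 := by
  have hζ := isPrimitiveRoot_unityRoot (n := 3) (by norm_num)
  have h1 : conj (unityRoot 3) * unityRoot 3 = 1 := by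
    rw [Complex.conj_mul', hζ.norm'_eq_one (by norm_num)]; simp
  apply mul_right_cancel₀ (hζ.ne_zero (by norm_num))
  linear_combination h1 + one_add_unityRoot_three

/-- Polarization: `conj a * b` is a discrete Fourier transform of the three numbers
`|a + ν^j b|²`, where `ν = e^{2πi/3}`. -/
theorem polarization_unityRoot_three (a b : ℂ) :
    ((-1 - unityRoot 3) * ((‖a + unityRoot 3 ^ 1 * b‖ ^ 2 : ℝ) : ℂ) +
      unityRoot 3 * ((‖a + unityRoot 3 ^ 2 * b‖ ^ 2 : ℝ) : ℂ) +
      ((‖a + unityRoot 3 ^ 3 * b‖ ^ 2 : ℝ) : ℂ)) = 3 * (conj a * b) := by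
  have h := one_add_unityRoot_three
  have h2 : unityRoot 3 ^ 2 = -1 - unityRoot 3 := by linear_combination h
  have h3 : unityRoot 3 ^ 3 = 1 :=
    (isPrimitiveRoot_unityRoot (n := 3) (by norm_num)).pow_eq_one
  rw [h2, h3]
  push_cast
  simp only [← Complex.conj_mul', map_add, map_mul, map_sub, map_neg, map_one,
    conj_unityRoot_three, pow_one, one_mul]
  linear_combination (-2 * (conj a * b) + 2 * (a * conj b) + b * conj b) * h

theorem norm_conj_mul_sub_le {a b a' b' : ℂ} {δ : ℝ}
    (h1 : |‖a + unityRoot 3 ^ 1 * b‖ ^ 2 - ‖a' + unityRoot 3 ^ 1 * b'‖ ^ 2| ≤ δ)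
    (h2 : |‖a + unityRoot 3 ^ 2 * b‖ ^ 2 - ‖a' + unityRoot 3 ^ 2 * b'‖ ^ 2| ≤ δ)
    (h3 : |‖a + unityRoot 3 ^ 3 * b‖ ^ 2 - ‖a' + unityRoot 3 ^ 3 * b'‖ ^ 2| ≤ δ) :
    ‖conj a * b - conj a' * b'‖ ≤ δ := by
  have hν : ‖unityRoot 3‖ = 1 := by simpa using norm_unityRoot_pow (n := 3) (by norm_num) 1
  have hν' : ‖-1 - unityRoot 3‖ = 1 := by rw [← conj_unityRoot_three, RCLike.norm_conj, hν]
  have key : 3 * (conj a * b - conj a' * b') =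
      (-1 - unityRoot 3) *
        ((‖a + unityRoot 3 ^ 1 * b‖ ^ 2 - ‖a' + unityRoot 3 ^ 1 * b'‖ ^ 2 : ℝ) : ℂ) +
      unityRoot 3 * ((‖a + unityRoot 3 ^ 2 * b‖ ^ 2 - ‖a' + unityRoot 3 ^ 2 * b'‖ ^ 2 : ℝ) : ℂ) +
      ((‖a + unityRoot 3 ^ 3 * b‖ ^ 2 - ‖a' + unityRoot 3 ^ 3 * b'‖ ^ 2 : ℝ) : ℂ) := by
    rw [mul_sub, ← polarization_unityRoot_three a b, ← polarization_unityRoot_three a' b']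
    push_cast
    ring
  have h := congrArg norm key
  rw [norm_mul] at h
  have hle : ‖(3 : ℂ)‖ * ‖conj a * b - conj a' * b'‖ ≤ δ + δ + δ := by
    rw [h]
    refine norm_add₃_le.trans (add_le_add (add_le_add ?_ ?_) ?_)
    · rwa [norm_mul, hν', one_mul, Complex.norm_real]
    · rwa [norm_mul, hν, one_mul, Complex.norm_real]
    · rwa [Complex.norm_real]
  have : ‖(3 : ℂ)‖ = 3 := by simp
  rw [this] at hle
  linarith

/-! ### Stability of the quotient -/

/-- The identity behind the estimate is `b / a = (conj a * b) / |a|²`. It expresses the logarithmic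
derivatives `b / a` and `b' / a'` by the two quantities that the measurements control. -/
theorem norm_quotient_derivative_le {a b a' b' : ℂ} {m M M' μ δ : ℝ} (hm : 0 < m) (hμ : 0 < μ)
    (ham : m ≤ ‖a‖) (haM : ‖a‖ ≤ M) (hb : ‖b‖ ≤ M') (ha' : μ ≤ ‖a'‖)
    (h0 : |‖a‖ ^ 2 - ‖a'‖ ^ 2| ≤ δ) (h1 : ‖conj a * b - conj a' * b'‖ ≤ δ) :
    ‖(b * a' - a * b') / a' ^ 2‖ ≤ M / μ * (M * M' / (m ^ 2 * μ ^ 2) + 1 / μ ^ 2) * δ := by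
  have hδ : 0 ≤ δ := (abs_nonneg _).trans h0
  have hM : 0 < M := hm.trans_le (ham.trans haM)
  have hM' : 0 ≤ M' := (norm_nonneg _).trans hb
  have hna : 0 < ‖a‖ := hm.trans_le ham
  have hna' : 0 < ‖a'‖ := hμ.trans_le ha'
  have ha0 : a ≠ 0 := norm_pos_iff.1 hna
  have ha0' : a' ≠ 0 := norm_pos_iff.1 hna'
  have hc0 : conj a ≠ 0 := (_root_.map_ne_zero _).2 ha0
  have hc0' : conj a' ≠ 0 := (_root_.map_ne_zero _).2 ha0'
  have key : (b * a' - a * b') / a' ^ 2 = a / a' *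
      (conj a * b * (((‖a'‖ ^ 2 - ‖a‖ ^ 2 : ℝ) : ℂ) / ((‖a‖ ^ 2 * ‖a'‖ ^ 2 : ℝ) : ℂ)) +
        (conj a * b - conj a' * b') / ((‖a'‖ ^ 2 : ℝ) : ℂ)) := by
    push_cast
    simp only [← Complex.conj_mul']
    field_simp
    ring
  rw [key, norm_mul, norm_div, mul_assoc (M / μ)]
  refine mul_le_mul (div_le_div₀ hM.le haM hμ ha') ?_ (norm_nonneg _) (by positivity)
  refine (norm_add_le _ _).trans ?_
  rw [add_mul]
  refine add_le_add ?_ ?_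
  · rw [norm_mul, norm_mul, norm_div, Complex.norm_real, Complex.norm_real, RCLike.norm_conj,
      Real.norm_eq_abs, abs_sub_comm, Real.norm_of_nonneg (by positivity), div_mul_eq_mul_div,
      mul_div_assoc]
    gcongr
  · rw [norm_div, Complex.norm_real, Real.norm_of_nonneg (by positivity), one_div_mul_eq_div]
    gcongr

/-- Two polynomials whose values `|p|²` and `conj p * p'` on the circle are close have a quotient
that is close to a unimodular constant. The proof integrates the bound on the derivative of `f / g`
along the circle, starting at `1`; the constant is `f 1 / g 1`, normalized. -/
theorem exists_norm_div_sub_le {f g : ℂ[X]} {m M M' μ δ : ℝ} (hm : 0 < m) (hμ : 0 < μ)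
    (hf : ∀ z : Circle, m ≤ ‖f.eval (z : ℂ)‖ ∧ ‖f.eval (z : ℂ)‖ ≤ M)
    (hf' : ∀ z : Circle, ‖f.derivative.eval (z : ℂ)‖ ≤ M')
    (hg : ∀ z : Circle, μ ≤ ‖g.eval (z : ℂ)‖)
    (h0 : ∀ z : Circle, |‖f.eval (z : ℂ)‖ ^ 2 - ‖g.eval (z : ℂ)‖ ^ 2| ≤ δ)
    (h1 : ∀ z : Circle, ‖conj (f.eval (z : ℂ)) * f.derivative.eval (z : ℂ) -
      conj (g.eval (z : ℂ)) * g.derivative.eval (z : ℂ)‖ ≤ δ) :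
    ∃ c : ℂ, ‖c‖ = 1 ∧ ∀ z : Circle, ‖f.eval (z : ℂ) / g.eval (z : ℂ) - c‖ ≤
      (M / μ * (M * M' / (m ^ 2 * μ ^ 2) + 1 / μ ^ 2) * Real.pi + 1 / μ ^ 2) * δ := by
  set B := M / μ * (M * M' / (m ^ 2 * μ ^ 2) + 1 / μ ^ 2)
  have hδ : 0 ≤ δ := (abs_nonneg _).trans (h0 1)
  have hg0 : ∀ z : Circle, g.eval (z : ℂ) ≠ 0 := fun z => norm_pos_iff.1 (hμ.trans_le (hg z))
  have hderiv : ∀ t : ℝ, HasDerivAt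
      (fun t : ℝ => f.eval (Circle.exp t : ℂ) / g.eval (Circle.exp t : ℂ))
      ((f.derivative.eval (Circle.exp t : ℂ) * g.eval (Circle.exp t : ℂ) -
        f.eval (Circle.exp t : ℂ) * g.derivative.eval (Circle.exp t : ℂ)) /
          g.eval (Circle.exp t : ℂ) ^ 2 * ((Circle.exp t : ℂ) * Complex.I)) t := by
    intro t
    have he : HasDerivAt (fun t : ℝ => (Circle.exp t : ℂ)) ((Circle.exp t : ℂ) * Complex.I) t := by
      simp only [Circle.coe_exp]
      simpa using ((hasDerivAt_id t).ofReal_comp.mul_const Complex.I).cexp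
    exact (((f.hasDerivAt _).div (g.hasDerivAt _) (hg0 _)).comp t he)
  have hbound : ∀ t : ℝ, ‖(f.derivative.eval (Circle.exp t : ℂ) * g.eval (Circle.exp t : ℂ) -
        f.eval (Circle.exp t : ℂ) * g.derivative.eval (Circle.exp t : ℂ)) /
          g.eval (Circle.exp t : ℂ) ^ 2 * ((Circle.exp t : ℂ) * Complex.I)‖ ≤ B * δ := by
    intro t
    rw [norm_mul, norm_mul, Circle.norm_coe, Complex.norm_I, mul_one, mul_one]
    exact norm_quotient_derivative_le hm hμ (hf _).1 (hf _).2 (hf' _) (hg _) (h0 _) (h1 _)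
  have hBδ : 0 ≤ B * δ := (norm_nonneg _).trans (hbound 0)
  have hmove : ∀ z : Circle, ‖f.eval (z : ℂ) / g.eval (z : ℂ) - f.eval 1 / g.eval 1‖ ≤
      B * δ * Real.pi := by
    intro z
    have h := convex_univ.norm_image_sub_le_of_norm_hasDerivWithin_le
      (fun t _ => (hderiv t).hasDerivWithinAt) (fun t _ => hbound t) (Set.mem_univ (0 : ℝ))
      (Set.mem_univ (Complex.arg z))
    simp only [Circle.exp_arg, Circle.exp_zero, Circle.coe_one, sub_zero] at h
    refine h.trans (mul_le_mul_of_nonneg_left ?_ hBδ)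
    exact Complex.abs_arg_le_pi z
  set r := f.eval 1 / g.eval 1 with hr
  have hf1 := hf 1
  have hg1 := hg 1
  have h01 := h0 1
  rw [Circle.coe_one] at hf1 hg1 h01
  have hgp : 0 < ‖g.eval 1‖ := hμ.trans_le hg1
  have hrn : 0 < ‖r‖ := by rw [hr, norm_div]; exact div_pos (hm.trans_le hf1.1) hgp
  have hr0 : (‖r‖ : ℂ) ≠ 0 := by exact_mod_cast hrn.ne'
  refine ⟨r / ‖r‖, ?_, fun z => ?_⟩
  · rw [norm_div, Complex.norm_real, norm_norm, div_self hrn.ne']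
  have hsq : |‖r‖ ^ 2 - 1| ≤ 1 / μ ^ 2 * δ := by
    have : ‖r‖ ^ 2 - 1 = (‖f.eval 1‖ ^ 2 - ‖g.eval 1‖ ^ 2) / ‖g.eval 1‖ ^ 2 := by
      rw [hr, norm_div]; field_simp
    rw [this, abs_div, abs_of_nonneg (sq_nonneg ‖g.eval 1‖), one_div_mul_eq_div]
    gcongr
  have hrc : ‖r - r / ‖r‖‖ ≤ 1 / μ ^ 2 * δ := by
    have h2 : r - r / ‖r‖ = r / ‖r‖ * ((‖r‖ - 1 : ℝ) : ℂ) := by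
      push_cast; field_simp
    rw [h2, norm_mul, norm_div, Complex.norm_real, norm_norm, div_self hrn.ne', one_mul,
      Complex.norm_real, Real.norm_eq_abs]
    refine le_trans ?_ hsq
    have h3 : ‖r‖ ^ 2 - 1 = (‖r‖ - 1) * (‖r‖ + 1) := by ring
    rw [h3, abs_mul, abs_of_pos (by linarith : 0 < ‖r‖ + 1)]
    exact le_mul_of_one_le_right (abs_nonneg _) (by linarith)
  calc ‖f.eval (z : ℂ) / g.eval (z : ℂ) - r / ‖r‖‖
      ≤ ‖f.eval (z : ℂ) / g.eval (z : ℂ) - r‖ + ‖r - r / ‖r‖‖ :=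
        norm_sub_le_norm_sub_add_norm_sub _ _ _
    _ ≤ B * δ * Real.pi + 1 / μ ^ 2 * δ := add_le_add (hmove z) hrc
    _ = (B * Real.pi + 1 / μ ^ 2) * δ := by ring

/-! ### Best fits to the data -/

/-- The differential operator `p ↦ p` for `j = 0`, and `p ↦ p + ν^j p'` with `ν = e^{2πi/3}` for
`j = 1, 2, 3`. The measurements are the squared moduli of its values at the nodes. -/
noncomputable def probe (j : Fin 4) : ℂ[X] →ₗ[ℂ] ℂ[X] :=
  if j = 0 then LinearMap.id else LinearMap.id + unityRoot 3 ^ (j : ℕ) • Polynomial.derivative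

theorem probe_zero_apply (p : ℂ[X]) : probe 0 p = p := by simp [probe]

theorem eval_probe {j : Fin 4} (hj : j ≠ 0) (p : ℂ[X]) (z : ℂ) :
    (probe j p).eval z = p.eval z + unityRoot 3 ^ (j : ℕ) * p.derivative.eval z := by
  simp [probe, hj]

theorem measurement_eq_probe (d : ℕ) (f : ℂ[X]) (l : Fin (2 * d - 1)) (j : Fin 4) :
    measurement d f l j = ‖(probe j f).eval (unityRoot (2 * d - 1) ^ (l : ℕ))‖ ^ 2 := by
  by_cases hj : j = 0
  · subst hj; simp [measurement, probe_zero_apply]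
  · simp [measurement, eval_probe hj, hj]

theorem probe_mem_degreeLT {d : ℕ} {p : ℂ[X]} (hp : p ∈ degreeLT ℂ d) (j : Fin 4) :
    probe j p ∈ degreeLT ℂ d := by
  by_cases hj : j = 0
  · subst hj; rwa [probe_zero_apply]
  · have hp' : Polynomial.derivative p ∈ degreeLT ℂ d := by
      rw [mem_degreeLT] at hp ⊢
      exact degree_derivative_le.trans_lt hp
    have : probe j p = p + unityRoot 3 ^ (j : ℕ) • Polynomial.derivative p := by simp [probe, hj]
    rw [this]
    exact add_mem hp (Submodule.smul_mem _ _ hp')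

/-- The polynomial `g` of degree less than `d` fits the data `y` up to the residual `t`: it has the
`L²` norm that the data prescribe, and each of its measurements deviates from the data by at most
`t` and by at most `t * min |g|`, the minimum being over the unit circle. -/
structure FitsData (d : ℕ) (y : Fin (2 * d - 1) → Fin 4 → ℝ) (g : ℂ[X]) (t : ℝ) : Prop where
  mem : g ∈ degreeLT ℂ d
  energy : ∑ l, measurement d g l 0 = ∑ l, y l 0
  residual : ∀ l j, |y l j - measurement d g l j| ≤ t
  residual_mul : ∀ l j (z : Circle), |y l j - measurement d g l j| ≤ t * ‖g.eval (z : ℂ)‖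

theorem FitsData.mono {d : ℕ} {y : Fin (2 * d - 1) → Fin 4 → ℝ} {g : ℂ[X]} {s t : ℝ}
    (h : FitsData d y g s) (hst : s ≤ t) : FitsData d y g t where
  mem := h.mem
  energy := h.energy
  residual l j := (h.residual l j).trans hst
  residual_mul l j z :=
    (h.residual_mul l j z).trans (mul_le_mul_of_nonneg_right hst (norm_nonneg _))

theorem FitsData.nonneg {d : ℕ} (hd : 0 < d) {y : Fin (2 * d - 1) → Fin 4 → ℝ} {g : ℂ[X]} {t : ℝ}
    (h : FitsData d y g t) : 0 ≤ t :=
  (abs_nonneg _).trans (h.residual ⟨0, by omega⟩ 0)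

/-- The polynomial with a given vector of coefficients. -/
noncomputable def ofCoeffs (d : ℕ) : (Fin d → ℂ) →ₗ[ℂ] ℂ[X] :=
  (degreeLT ℂ d).subtype ∘ₗ (degreeLTEquiv ℂ d).symm.toLinearMap

theorem ofCoeffs_mem (d : ℕ) (a : Fin d → ℂ) : ofCoeffs d a ∈ degreeLT ℂ d :=
  ((degreeLTEquiv ℂ d).symm a).2

theorem coeff_ofCoeffs (d : ℕ) (a : Fin d → ℂ) (i : Fin d) : (ofCoeffs d a).coeff i = a i :=
  congrFun ((degreeLTEquiv ℂ d).apply_symm_apply a) i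

theorem exists_ofCoeffs_eq {d : ℕ} {p : ℂ[X]} (hp : p ∈ degreeLT ℂ d) : ∃ a, ofCoeffs d a = p :=
  ⟨degreeLTEquiv ℂ d ⟨p, hp⟩, by simp [ofCoeffs]⟩

theorem continuous_norm_eval_probe_ofCoeffs (d : ℕ) (j : Fin 4) (z : ℂ) :
    Continuous fun a : Fin d → ℂ => ‖(probe j (ofCoeffs d a)).eval z‖ :=
  continuous_norm.comp
    (LinearMap.continuous_of_finiteDimensional (leval z ∘ₗ probe j ∘ₗ ofCoeffs d))

theorem isCompact_setOf_fitsData {d : ℕ} (hd : 0 < d) (y : Fin (2 * d - 1) → Fin 4 → ℝ) (T : ℝ) :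
    IsCompact {x : (Fin d → ℂ) × ℝ | FitsData d y (ofCoeffs d x.1) x.2 ∧ x.2 ≤ T} := by
  refine Metric.isCompact_of_isClosed_isBounded ?_ ?_
  · have hmeas : ∀ l j, Continuous fun x : (Fin d → ℂ) × ℝ =>
        measurement d (ofCoeffs d x.1) l j := by
      intro l j
      simp_rw [measurement_eq_probe]
      exact ((continuous_norm_eval_probe_ofCoeffs d j _).comp continuous_fst).pow 2
    have heval : ∀ z : ℂ, Continuous fun x : (Fin d → ℂ) × ℝ => ‖(ofCoeffs d x.1).eval z‖ := by
      intro z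
      have h := (continuous_norm_eval_probe_ofCoeffs d 0 z).comp (continuous_fst (Y := ℝ))
      simp only [probe_zero_apply] at h
      exact h
    have hset : {x : (Fin d → ℂ) × ℝ | FitsData d y (ofCoeffs d x.1) x.2 ∧ x.2 ≤ T} =
        {x | ∑ l, measurement d (ofCoeffs d x.1) l 0 = ∑ l, y l 0} ∩
        (⋂ l, ⋂ j, {x | |y l j - measurement d (ofCoeffs d x.1) l j| ≤ x.2}) ∩
        (⋂ l, ⋂ j, ⋂ z : Circle, {x | |y l j - measurement d (ofCoeffs d x.1) l j| ≤
          x.2 * ‖(ofCoeffs d x.1).eval (z : ℂ)‖}) ∩ {x | x.2 ≤ T} := by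
      ext x
      simp only [Set.mem_ofPred_eq, Set.mem_inter_iff, Set.mem_iInter]
      constructor
      · rintro ⟨⟨-, h1, h2, h3⟩, h4⟩
        exact ⟨⟨⟨h1, h2⟩, h3⟩, h4⟩
      · rintro ⟨⟨⟨h1, h2⟩, h3⟩, h4⟩
        exact ⟨⟨ofCoeffs_mem d _, h1, h2, h3⟩, h4⟩
    rw [hset]
    refine (((isClosed_eq (continuous_finsetSum _ fun l _ => hmeas l 0) continuous_const).inter
      ?_).inter ?_).inter (isClosed_le continuous_snd continuous_const)
    · exact isClosed_iInter fun l => isClosed_iInter fun j =>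
        isClosed_le (continuous_const.sub (hmeas l j)).abs continuous_snd
    · exact isClosed_iInter fun l => isClosed_iInter fun j => isClosed_iInter fun z =>
        isClosed_le (continuous_const.sub (hmeas l j)).abs (continuous_snd.mul (heval _))
  -- Each coefficient is bounded by the values at the nodes, and these by the prescribed energy.
  · refine ((Metric.isBounded_closedBall (x := (0 : Fin d → ℂ)) (r := √(∑ l, y l 0))).prod
      (Metric.isBounded_Icc (0 : ℝ) T)).subset ?_
    rintro ⟨a, t⟩ ⟨h, hT⟩
    refine ⟨?_, h.nonneg hd, hT⟩
    rw [mem_closedBall_zero_iff, pi_norm_le_iff_of_nonneg (Real.sqrt_nonneg _)]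
    intro i
    change ‖a i‖ ≤ _
    rw [← coeff_ofCoeffs d a i]
    have hlt := natDegree_lt_of_mem_degreeLT hd h.mem
    refine norm_coeff_le_of_norm_eval_unityRoot_le (n := 2 * d - 1) (by dsimp at hlt ⊢; omega)
      (fun l => Real.le_sqrt_of_sq_le ?_) (by have := i.2; omega)
    rw [← h.energy]
    refine le_trans (le_of_eq ?_) (Finset.single_le_sum
      (f := fun l => measurement d (ofCoeffs d a) l 0) (fun l _ => ?_) (mem_univ l))
    · simp [measurement_eq_probe, probe_zero_apply]
    · simp only [measurement_eq_probe]; positivity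

/-- There is a polynomial that fits the data at least as well as every other one. For data that
no polynomial fits, the statement is vacuous and `g` is arbitrary. -/
theorem exists_best_fit {d : ℕ} (hd : 0 < d) (y : Fin (2 * d - 1) → Fin 4 → ℝ) :
    ∃ g : degreeLT ℂ d, ∀ h t, FitsData d y h t → FitsData d y g t := by
  by_cases hex : ∃ h t, FitsData d y h t
  · obtain ⟨h₀, T, hT⟩ := hex
    obtain ⟨a₀, rfl⟩ := exists_ofCoeffs_eq hT.mem
    obtain ⟨x, ⟨hx, hxT⟩, hmin⟩ := (isCompact_setOf_fitsData hd y T).exists_isMinOn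
      ⟨(a₀, T), hT, le_rfl⟩ continuous_snd.continuousOn
    refine ⟨⟨ofCoeffs d x.1, hx.mem⟩, fun h t ht => hx.mono ?_⟩
    obtain ⟨a, rfl⟩ := exists_ofCoeffs_eq ht.mem
    by_cases htT : t ≤ T
    · exact hmin (a := (a, t)) ⟨ht, htT⟩
    · exact hxT.trans (not_le.1 htT).le
  · exact ⟨0, fun h t ht => absurd ⟨h, t, ht⟩ hex⟩

/-! ### The signal, the best fit and the data -/

theorem natCast_two_mul_sub_one {d : ℕ} (hd : 0 < d) :
    ((2 * d - 1 : ℕ) : ℝ) = 2 * (d : ℝ) - 1 := by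
  rw [Nat.cast_sub (by omega)]; push_cast; ring

theorem circleL2Norm_eq {d : ℕ} (hd : 0 < d) {p : ℂ[X]} (hp : p ∈ degreeLT ℂ d) :
    circleL2Norm p = √(2 * Real.pi / (2 * (d : ℝ) - 1) * ∑ l, measurement d p l 0) := by
  rw [circleL2Norm, integral_normSq_eval hd hp]
  simp only [measurement_eq_probe, probe_zero_apply]

theorem norm_eval_probe_le {f : ℂ[X]} {M M' : ℝ} {z : ℂ} (hz : ‖f.eval z‖ ≤ M)
    (hz' : ‖f.derivative.eval z‖ ≤ M') (j : Fin 4) : ‖(probe j f).eval z‖ ≤ M + M' := by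
  have hM' : 0 ≤ M' := (norm_nonneg _).trans hz'
  by_cases hj : j = 0
  · subst hj; rw [probe_zero_apply]; linarith
  · rw [eval_probe hj]
    refine (norm_add_le _ _).trans (add_le_add hz ?_)
    rwa [norm_mul, norm_unityRoot_pow (by norm_num), one_mul]

theorem measurement_smul (d : ℕ) (s : ℝ) (f : ℂ[X]) (l : Fin (2 * d - 1)) (j : Fin 4) :
    measurement d ((s : ℂ) • f) l j = s ^ 2 * measurement d f l j := by
  simp only [measurement_eq_probe, map_smul, eval_smul, norm_smul, Complex.norm_real, mul_pow,
    Real.norm_eq_abs, sq_abs]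

theorem abs_sqrt_sub_sqrt_le {a b r : ℝ} (ha : 0 ≤ a) (hr : 0 < r) (hb : r ^ 2 ≤ b) :
    |√a - √b| ≤ |a - b| / r := by
  have hb0 : 0 ≤ b := (sq_nonneg r).trans hb
  have h1 : r ≤ √a + √b := by
    have := Real.le_sqrt_of_sq_le hb
    have := Real.sqrt_nonneg a
    linarith
  have h2 : a - b = (√a - √b) * (√a + √b) := by
    linear_combination -Real.sq_sqrt ha + Real.sq_sqrt hb0
  rw [le_div_iff₀ hr, h2, abs_mul, abs_of_pos (hr.trans_le h1)]
  exact mul_le_mul_of_nonneg_left h1 (abs_nonneg _)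

/-- Since `noiseBeta ≤ 1 / 3`, the admissible noise levels satisfy `ε ≤ m² / (3 (2d - 1))`, which is
all that the estimates use. -/
theorem two_mul_sub_one_mul_le_of_lt_noiseBeta {d : ℕ} (hd : 0 < d) {m M M' ε : ℝ} (hm : 0 < m)
    (hM : 0 < M) (hM' : 0 < M') (hε : 0 < ε)
    (h : ε < noiseBeta d m M M' * m ^ 2 / ((2 * (d : ℝ) - 1) * d)) :
    ((2 * d - 1 : ℕ) : ℝ) * ε ≤ m ^ 2 / 3 := by
  have hd1 : (1 : ℝ) ≤ d := by exact_mod_cast hd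
  have hβ : noiseBeta d m M M' ≤ 1 / 3 := by
    have : 0 ≤ (((d : ℝ) - 1) * M + M') / m :=
      div_nonneg (add_nonneg (mul_nonneg (by linarith) hM.le) hM'.le) hm.le
    exact one_div_le_one_div_of_le (by norm_num) (by linarith)
  have hN : (0 : ℝ) < 2 * (d : ℝ) - 1 := by linarith
  rw [natCast_two_mul_sub_one hd]
  rw [lt_div_iff₀ (mul_pos hN (by linarith))] at h
  have h1 : noiseBeta d m M M' * m ^ 2 ≤ 1 / 3 * m ^ 2 :=
    mul_le_mul_of_nonneg_right hβ (sq_nonneg m)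
  have h2 : (2 * (d : ℝ) - 1) * ε ≤ (2 * (d : ℝ) - 1) * ε * d :=
    le_mul_of_one_le_right (by positivity) hd1
  linarith

theorem abs_sum_sub_sum_measurement_le {d : ℕ} {f : ℂ[X]} {ε : ℝ}
    {y : Fin (2 * d - 1) → Fin 4 → ℝ} (hy : ∀ l j, |y l j - measurement d f l j| ≤ ε) :
    |∑ l, y l 0 - ∑ l, measurement d f l 0| ≤ ((2 * d - 1 : ℕ) : ℝ) * ε := by
  rw [← Finset.sum_sub_distrib]
  refine (Finset.abs_sum_le_sum_abs _ _).trans ((Finset.sum_le_sum fun l _ => hy l 0).trans ?_)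
  simp

theorem le_sum_measurement_zero {d : ℕ} {f : ℂ[X]} {m : ℝ} (hm : 0 ≤ m)
    (hf : ∀ z : Circle, m ≤ ‖f.eval (z : ℂ)‖) :
    ((2 * d - 1 : ℕ) : ℝ) * m ^ 2 ≤ ∑ l, measurement d f l 0 := by
  have h : ∀ l, m ^ 2 ≤ measurement d f l 0 := by
    intro l
    have hn : 2 * d - 1 ≠ 0 := by have := l.2; omega
    rw [measurement_eq_probe, probe_zero_apply]
    exact pow_le_pow_left₀ hm
      (hf ⟨_, mem_sphere_zero_iff_norm.2 (norm_unityRoot_pow hn (l : ℕ))⟩) 2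
  simpa using Finset.card_nsmul_le_sum univ _ (m ^ 2) fun l _ => h l

/-- The constant `K` such that rescaling the signal to the norm prescribed by the data gives a
polynomial that fits the data up to the residual `K ε`. The summands `1` and `2 / m` of the second
factor serve the two bounds in `FitsData`: the rescaled signal is at least `m / 2` in modulus. -/
noncomputable def fitConst (m M M' : ℝ) : ℝ :=
  ((M + M') ^ 2 / m ^ 2 + 1) * (1 + 2 / m)

theorem fitConst_pos {m M M' : ℝ} (hm : 0 < m) : 0 < fitConst m M M' := by
  unfold fitConst; positivity

theorem exists_fitsData {d : ℕ} (hd : 0 < d) {f : ℂ[X]} (hfd : f ∈ degreeLT ℂ d) {m M M' ε : ℝ}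
    (hm : 0 < m) (hf : ∀ z : Circle, m ≤ ‖f.eval (z : ℂ)‖ ∧ ‖f.eval (z : ℂ)‖ ≤ M)
    (hf' : ∀ z : Circle, ‖f.derivative.eval (z : ℂ)‖ ≤ M')
    (hε : ((2 * d - 1 : ℕ) : ℝ) * ε ≤ m ^ 2 / 3) {y : Fin (2 * d - 1) → Fin 4 → ℝ}
    (hy : ∀ l j, |y l j - measurement d f l j| ≤ ε) :
    ∃ h, FitsData d y h (fitConst m M M' * ε) := by
  have hn : 2 * d - 1 ≠ 0 := by omega
  have hε0 : 0 ≤ ε := (abs_nonneg _).trans (hy ⟨0, by omega⟩ 0)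
  have hN1 : (1 : ℝ) ≤ ((2 * d - 1 : ℕ) : ℝ) := by exact_mod_cast Nat.one_le_iff_ne_zero.2 hn
  have hN : (0 : ℝ) < ((2 * d - 1 : ℕ) : ℝ) := by linarith
  have hε1 : ε ≤ m ^ 2 / 3 := (le_mul_of_one_le_left hε0 hN1).trans hε
  have hS := le_sum_measurement_zero (d := d) hm.le fun z => (hf z).1
  have hY := abs_sum_sub_sum_measurement_le hy
  set S := ∑ l, measurement d f l 0
  set Y := ∑ l, y l 0
  have hm2 : 0 < m ^ 2 := by positivity
  have hS0 : 0 < S := (mul_pos hN hm2).trans_le hS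
  have hratio : |Y / S - 1| ≤ ε / m ^ 2 := by
    rw [div_sub_one hS0.ne', abs_div, abs_of_pos hS0, div_le_div_iff₀ hS0 hm2]
    calc |Y - S| * m ^ 2 ≤ ((2 * d - 1 : ℕ) : ℝ) * ε * m ^ 2 := by gcongr
      _ = ε * (((2 * d - 1 : ℕ) : ℝ) * m ^ 2) := by ring
      _ ≤ ε * S := by gcongr
  have hthird : ε / m ^ 2 ≤ 1 / 3 := by
    rw [div_le_div_iff₀ hm2 (by norm_num)]; linarith
  have hs14 : (1 / 2 : ℝ) ^ 2 ≤ Y / S := by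
    have := (abs_le.1 (hratio.trans hthird)).1
    linarith
  -- `s` is the factor by which `f` is rescaled to the norm prescribed by the data.
  set s := √(Y / S) with hs
  have hs2 : s ^ 2 = Y / S := Real.sq_sqrt (by linarith [sq_nonneg (1 / 2 : ℝ)])
  have hs12 : 1 / 2 ≤ s := Real.le_sqrt_of_sq_le hs14
  have hres : ∀ l j, |y l j - measurement d ((s : ℂ) • f) l j| ≤
      ((M + M') ^ 2 / m ^ 2 + 1) * ε := by
    intro l j
    let w : Circle :=
      ⟨unityRoot (2 * d - 1) ^ (l : ℕ), mem_sphere_zero_iff_norm.2 (norm_unityRoot_pow hn (l : ℕ))⟩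
    have hmeas : measurement d f l j ≤ (M + M') ^ 2 := by
      rw [measurement_eq_probe]
      exact pow_le_pow_left₀ (norm_nonneg _) (norm_eval_probe_le (hf w).2 (hf' w) j) 2
    have hmeas0 : 0 ≤ measurement d f l j := by rw [measurement_eq_probe]; positivity
    have hsplit : y l j - measurement d ((s : ℂ) • f) l j =
        (y l j - measurement d f l j) - (Y / S - 1) * measurement d f l j := by
      rw [measurement_smul, hs2]; ring
    rw [hsplit]
    calc |(y l j - measurement d f l j) - (Y / S - 1) * measurement d f l j|
        ≤ |y l j - measurement d f l j| + |Y / S - 1| * measurement d f l j := by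
          refine (abs_sub _ _).trans (le_of_eq ?_)
          rw [abs_mul, abs_of_nonneg hmeas0]
      _ ≤ ε + ε / m ^ 2 * (M + M') ^ 2 := by
          gcongr
          exact hy l j
      _ = ((M + M') ^ 2 / m ^ 2 + 1) * ε := by ring
  have hK : fitConst m M M' * ε = ((M + M') ^ 2 / m ^ 2 + 1) * ε * (1 + 2 / m) := by
    unfold fitConst; ring
  have hA : 0 ≤ ((M + M') ^ 2 / m ^ 2 + 1) * ε := by positivity
  refine ⟨(s : ℂ) • f, Submodule.smul_mem _ _ hfd, ?_, fun l j => ?_, fun l j z => ?_⟩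
  · simp_rw [measurement_smul, ← Finset.mul_sum, hs2]
    exact div_mul_cancel₀ _ hS0.ne'
  · refine (hres l j).trans ?_
    rw [hK]
    exact le_mul_of_one_le_right hA (le_add_of_nonneg_right (by positivity))
  · refine (hres l j).trans ?_
    rw [hK, mul_assoc]
    refine le_mul_of_one_le_right hA ?_
    have h1 : m / 2 ≤ ‖((s : ℂ) • f).eval (z : ℂ)‖ := by
      rw [eval_smul, norm_smul, Complex.norm_real, Real.norm_of_nonneg (by linarith)]
      have := mul_le_mul hs12 (hf z).1 hm.le (by linarith)
      linarith
    calc (1 : ℝ) = 2 / m * (m / 2) := by field_simp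
      _ ≤ (1 + 2 / m) * ‖((s : ℂ) • f).eval (z : ℂ)‖ := by
        gcongr
        linarith

/-- If both `f` and `g` have measurements near the data `y`, then on the whole circle they are
close in each of the four sampled trigonometric polynomials. -/
theorem abs_normSq_probe_sub_le_of_data {d : ℕ} (hd : 0 < d) {y : Fin (2 * d - 1) → Fin 4 → ℝ}
    {f g : ℂ[X]} {t ε : ℝ} (hfd : f ∈ degreeLT ℂ d) (hgd : g ∈ degreeLT ℂ d)
    (hy : ∀ l j, |y l j - measurement d f l j| ≤ ε)
    (hres : ∀ l j, |y l j - measurement d g l j| ≤ t) (j : Fin 4) (z : Circle) :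
    |‖(probe j f).eval (z : ℂ)‖ ^ 2 - ‖(probe j g).eval (z : ℂ)‖ ^ 2| ≤
      ((2 * d - 1 : ℕ) : ℝ) * (t + ε) := by
  refine abs_normSq_sub_le hd (probe_mem_degreeLT hfd j) (probe_mem_degreeLT hgd j)
    (fun l => ?_) z.norm_coe
  rw [← measurement_eq_probe, ← measurement_eq_probe]
  have h := abs_sub_le (measurement d f l j) (y l j) (measurement d g l j)
  rw [abs_sub_comm _ (y l j)] at h
  linarith [hy l j, hres l j]

/-- The residual bound proportional to `|g z|` turns closeness of `|g|²` to `|f|²` into a lower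
bound for `|g|` that does not degenerate when the noise level is bounded away from zero. -/
theorem FitsData.le_norm_eval {d : ℕ} (hd : 0 < d) {y : Fin (2 * d - 1) → Fin 4 → ℝ}
    {f g : ℂ[X]} {m K ε : ℝ} (hm : 0 < m) (hK : 0 < K) (hfd : f ∈ degreeLT ℂ d)
    (hf : ∀ z : Circle, m ≤ ‖f.eval (z : ℂ)‖)
    (hg : FitsData d y g (K * ε)) (hε : ((2 * d - 1 : ℕ) : ℝ) * ε ≤ m ^ 2 / 3)
    (hy : ∀ l j, |y l j - measurement d f l j| ≤ ε) (z : Circle) :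
    min (m / 2) (1 / K) ≤ ‖g.eval (z : ℂ)‖ := by
  by_contra! hlt
  have h := abs_normSq_probe_sub_le_of_data hd hfd hg.mem hy (fun l j => hg.residual_mul l j z) 0 z
  rw [probe_zero_apply, probe_zero_apply] at h
  set x := ‖g.eval (z : ℂ)‖
  have hx0 : 0 ≤ x := norm_nonneg _
  have hx1 : x < m / 2 := hlt.trans_le (min_le_left _ _)
  have hx2 : K * x ≤ 1 := by
    have := (hlt.trans_le (min_le_right _ _)).le
    rwa [le_div_iff₀ hK, mul_comm] at this
  have hfz : m ^ 2 ≤ ‖f.eval (z : ℂ)‖ ^ 2 := pow_le_pow_left₀ hm.le (hf z) 2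
  have hxsq : x ^ 2 < (m / 2) ^ 2 := pow_lt_pow_left₀ hx1 hx0 two_ne_zero
  have hε0 : 0 ≤ ((2 * d - 1 : ℕ) : ℝ) * ε :=
    mul_nonneg (Nat.cast_nonneg _) ((abs_nonneg _).trans (hy ⟨0, by omega⟩ 0))
  have h1 : ((2 * d - 1 : ℕ) : ℝ) * (K * ε * x + ε) ≤
      ((2 * d - 1 : ℕ) : ℝ) * ε + ((2 * d - 1 : ℕ) : ℝ) * ε := by
    have := mul_le_of_le_one_right hε0 hx2
    linarith
  -- Now `m² ≤ |f|² ≤ x² + 2 (2d - 1) ε < m² / 4 + 2 m² / 3`, which is absurd.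
  have h2 := (le_abs_self _).trans h
  have hm2 : 0 < m ^ 2 := by positivity
  linarith

theorem mainTheorem3 (d : ℕ) (hd : 0 < d) :
    ∃ R : (Fin (2 * d - 1) → Fin 4 → ℝ) → Polynomial.degreeLT ℂ d,
      ∀ m M M' : ℝ, 0 < m → 0 < M → 0 < M' →
        ∃ C : ℝ, 0 < C ∧
          ∀ f : Polynomial ℂ, f ∈ Polynomial.degreeLT ℂ d →
            (∀ z : Circle, m ≤ ‖f.eval (z : ℂ)‖ ∧ ‖f.eval (z : ℂ)‖ ≤ M) →
            (∀ z : Circle, ‖f.derivative.eval (z : ℂ)‖ ≤ M') →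
            ∀ ε : ℝ, 0 < ε →
              ε < noiseBeta d m M M' * m ^ 2 / ((2 * (d : ℝ) - 1) * d) →
              ∀ y : Fin (2 * d - 1) → Fin 4 → ℝ,
                (∀ l j, |y l j - measurement d f l j| ≤ ε) →
                |normEstimate d y - circleL2Norm f| ≤ C * ε ∧
                circleL2Norm (R y : Polynomial ℂ) = normEstimate d y ∧
                (∀ z : Circle, (R y : Polynomial ℂ).eval (z : ℂ) ≠ 0) ∧
                ∃ c : ℂ, ‖c‖ = 1 ∧
                  circleSupNorm
                    (fun z => f.eval z / (R y : Polynomial ℂ).eval z - c) ≤ C * ε := by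
  choose R hR using exists_best_fit hd
  refine ⟨R, fun m M M' hm hM hM' => ?_⟩
  set K := fitConst m M M'
  have hK : 0 < K := fitConst_pos hm
  set μ := min (m / 2) (1 / K)
  have hμ : 0 < μ := lt_min (by positivity) (by positivity)
  set N : ℝ := ((2 * d - 1 : ℕ) : ℝ) with hNdef
  have hN : 0 < N := by rw [hNdef]; exact_mod_cast (by omega : 0 < 2 * d - 1)
  set A := M / μ * (M * M' / (m ^ 2 * μ ^ 2) + 1 / μ ^ 2) * Real.pi + 1 / μ ^ 2
  have hpi := Real.pi_pos
  have hA : 0 < A := by positivity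
  refine ⟨2 * Real.pi / m + A * (N * (K + 1)), by positivity, ?_⟩
  intro f hfd hf hf' ε hε hεβ y hy
  have hεN := two_mul_sub_one_mul_le_of_lt_noiseBeta hd hm hM hM' hε hεβ
  obtain ⟨h, hh⟩ := exists_fitsData hd hfd hm hf hf' hεN hy
  have hg := hR y h _ hh
  have hlow := hg.le_norm_eval hd hm hK hfd (fun z => (hf z).1) hεN hy
  have hdiff := abs_normSq_probe_sub_le_of_data hd hfd hg.mem hy hg.residual
  refine ⟨?_, ?_, fun z => norm_pos_iff.1 (hμ.trans_le (hlow z)), ?_⟩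
  · rw [normEstimate, circleL2Norm_eq hd hfd, ← natCast_two_mul_sub_one hd]
    have hS := le_sum_measurement_zero (d := d) hm.le fun z => (hf z).1
    have hY := abs_sum_sub_sum_measurement_le hy
    have hY0 : 0 ≤ ∑ l, y l 0 := by
      rw [← hg.energy]
      exact Finset.sum_nonneg fun l _ => by rw [measurement_eq_probe]; positivity
    have hr : m ^ 2 ≤ 2 * Real.pi / N * ∑ l, measurement d f l 0 := by
      calc m ^ 2 = 1 / N * (N * m ^ 2) := by field_simp
        _ ≤ 2 * Real.pi / N * ∑ l, measurement d f l 0 := by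
          gcongr
          linarith [Real.pi_gt_three]
    refine (abs_sqrt_sub_sqrt_le (by positivity) hm hr).trans ?_
    rw [← mul_sub, abs_mul, abs_of_pos (by positivity)]
    calc 2 * Real.pi / N * |∑ l, y l 0 - ∑ l, measurement d f l 0| / m
        ≤ 2 * Real.pi / N * (N * ε) / m := by gcongr
      _ = 2 * Real.pi / m * ε := by field_simp
      _ ≤ (2 * Real.pi / m + A * (N * (K + 1))) * ε := by
        gcongr
        exact le_add_of_nonneg_right (by positivity)
  · rw [circleL2Norm_eq hd hg.mem, hg.energy, normEstimate]
  · have hprobe : ∀ j : Fin 4, j ≠ 0 → ∀ z : Circle,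
        |‖f.eval (z : ℂ) + unityRoot 3 ^ (j : ℕ) * f.derivative.eval (z : ℂ)‖ ^ 2 -
          ‖(R y : ℂ[X]).eval (z : ℂ) +
            unityRoot 3 ^ (j : ℕ) * (R y : ℂ[X]).derivative.eval (z : ℂ)‖ ^ 2| ≤
          N * (K * ε + ε) := by
      intro j hj z
      rw [← eval_probe hj, ← eval_probe hj]
      exact hdiff j z
    obtain ⟨c, hc, hle⟩ := exists_norm_div_sub_le (δ := N * (K * ε + ε)) hm hμ hf hf' hlow
      (fun z => by simpa only [probe_zero_apply] using hdiff 0 z)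
      (fun z => norm_conj_mul_sub_le
        (hprobe 1 (by decide) z)
        (hprobe 2 (by decide) z)
        (hprobe 3 (by decide) z))
    refine ⟨c, hc, ciSup_le fun z => (hle z).trans ?_⟩
    calc A * (N * (K * ε + ε)) = A * (N * (K + 1)) * ε := by ring
      _ ≤ (2 * Real.pi / m + A * (N * (K + 1))) * ε := by
        gcongr
        exact le_add_of_nonneg_left (by positivity)
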